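/- Let $\mathcal L$ be a relational language and let $\mathcal M$ be a non-empty countable homogeneous $\mathcal L$-structure (every isomorphism between finite substructures extends to an automorphism) whose age $\mathcal C$, the class of finite structures embeddable in $\mathcal M$, has the strong amalgamation property: whenever $A,B,C\in\mathcal C$ and $A$ embeds in $B$ and in $C$, there are $D\in\mathcal C$ and embeddings of $B$ and $C$ into $D$ which agree on $A$ and whose images intersect exactly in the image of $A$ (here $A$ may be empty). Let $\mathcal L^{<}=\mathcal L\cup\{<\}$ with $<$ a new binary relation symbol, and let $\mathcal M^{<}$ be the linear order expansion of $\mathcal M$, that is, the Fraïssé limit of the class $\mathcal C^{<}$ of all $\mathcal L^{<}$-structures whose $\mathcal L$-reduct lies in $\mathcal C$ and in which $<$ is a linear order. Let $g\in\mathrm{Aut}(\mathcal M^{<})$ be unbounded, i.e. there is no $a\in\mathcal M^{<}$ such that $gb=b$ for all $b>a$, and there is no $a\in\mathcal M^{<}$ such that $gb=b$ for all $b<a$. For $f\in\mathrm{Aut}(\mathcal M^{<})$ and $a\in\mathcal M^{<}$, the orbital of $f$ containing $a$ is the set of $x$ with $f^{m}a\le x\le f^{n}a$ for some $m,n\in\mathbb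 Z$; it is a $+$-orbital (resp. $-$-orbital) if $fx>x$ (resp. $fx<x$) for all $x$ in it. We say that $f$ has a single $+$-orbital (resp. single $-$-orbital) if for some $a\in\mathcal M^{<}$ the sequence $(f^{i}a)_{i\in\mathbb Z}$ is unbounded above and below in $\mathcal M^{<}$ and the orbital of $f$ containing $a$ is a $+$-orbital (resp. a $-$-orbital). Then there is a finite product of conjugates (in $\mathrm{Aut}(\mathcal M^{<})$) of $g$ and $g^{-1}$ that has a single $+$-orbital, and there is a finite product of conjugates of $g$ and $g^{-1}$ that has a single $-$-orbital. -/

import Mathlib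

open FirstOrder FirstOrder.Language CategoryTheory

universe u v w

namespace LinExp

/-- The automorphism group of a first-order structure, multiplication being composition. -/
instance autGroup {L : FirstOrder.Language.{u, v}} {M : Type w} [L.Structure M] : Group (M ≃[L] M) where
  mul g h := g.comp h
  one := FirstOrder.Language.Equiv.refl L M
  inv g := g.symm
  mul_assoc _ _ _ := rfl
  one_mul _ := rfl
  mul_one _ := rfl
  inv_mul_cancel g := by
    ext x
    exact g.symm_apply_apply x

/-- The strong amalgamation property: any two structures in `K` with a common substructure `A` in
`K` embed over `A` into a structure in `K` in such a way that their images meet exactly in the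
image of `A`. (Empty structures are allowed.) -/
def StrongAmalgamation {L : FirstOrder.Language.{u, v}} (K : Set (Bundled.{w} L.Structure)) : Prop :=
  ∀ (A B C : Bundled.{w} L.Structure) (AB : A ↪[L] B) (AC : A ↪[L] C),
    A ∈ K → B ∈ K → C ∈ K →
      ∃ (D : Bundled.{w} L.Structure) (BD : B ↪[L] D) (CD : C ↪[L] D),
        D ∈ K ∧ BD.comp AB = CD.comp AC ∧
          Set.range BD ∩ Set.range CD = Set.range (BD.comp AB)

/-- The class of all expansions of members of `K` by a linear order: structures in the language
`L` together with one more binary relation symbol (for the order), such that the `L`-reduct lies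
in `K` and the new symbol is interpreted as a linear order. -/
def orderExpansionClass {L : FirstOrder.Language.{u, v}} (K : Set (Bundled.{w} L.Structure)) :
    Set (Bundled.{w} (L.sum Language.order).Structure) :=
  {A | (⟨A, (LHom.sumInl : L →ᴸ L.sum Language.order).reduct A⟩ : Bundled.{w} L.Structure) ∈ K ∧
    A ⊨ (L.sum Language.order).linearOrderTheory}

section Automorphisms

variable {L : FirstOrder.Language.{u, v}} {N : Type w} [L.Structure N] [LinearOrder N]

/-- `g` fixes some final segment `(a, ∞)` pointwise. -/
def RightBounded (g : N ≃[L] N) : Prop := ∃ a : N, ∀ b : N, a < b → g b = b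

/-- `g` fixes some initial segment `(-∞, a)` pointwise. -/
def LeftBounded (g : N ≃[L] N) : Prop := ∃ a : N, ∀ b : N, b < a → g b = b

/-- `g` is neither left-bounded nor right-bounded. -/
def Unbounded (g : N ≃[L] N) : Prop := ¬ LeftBounded g ∧ ¬ RightBounded g

/-- The convexification of a subset of a linear order. -/
def convexification (S : Set N) : Set N := {a | ∃ s₁ ∈ S, ∃ s₂ ∈ S, s₁ ≤ a ∧ a ≤ s₂}

/-- The orbital of `g` containing `a`: the convexification of `{g ^ n a | n ∈ ℤ}`. -/
def orbital (g : N ≃[L] N) (a : N) : Set N :=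
  convexification (Set.range fun n : ℤ => (g ^ n : N ≃[L] N) a)

/-- `I` is a `+`-orbital of `g`. -/
def IsPlusOrbital (g : N ≃[L] N) (I : Set N) : Prop :=
  (∃ a, I = orbital g a) ∧ ∀ a ∈ I, a < g a

/-- `I` is a `-`-orbital of `g`. -/
def IsMinusOrbital (g : N ≃[L] N) (I : Set N) : Prop :=
  (∃ a, I = orbital g a) ∧ ∀ a ∈ I, g a < a

/-- The sequence `(g ^ i a)`, `i ∈ ℤ`, is unbounded above and below. -/
def OrbitUnbounded (g : N ≃[L] N) (a : N) : Prop :=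
  (∀ x : N, ∃ i : ℤ, x < (g ^ i : N ≃[L] N) a) ∧ ∀ x : N, ∃ i : ℤ, (g ^ i : N ≃[L] N) a < x

/-- `g` has a single orbital, and that orbital is a `+`-orbital. -/
def HasSinglePlusOrbital (g : N ≃[L] N) : Prop :=
  ∃ a : N, OrbitUnbounded g a ∧ IsPlusOrbital g (orbital g a)

/-- `g` has a single orbital, and that orbital is a `-`-orbital. -/
def HasSingleMinusOrbital (g : N ≃[L] N) : Prop :=
  ∃ a : N, OrbitUnbounded g a ∧ IsMinusOrbital g (orbital g a)

end Automorphisms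

/-- In a group, `f` is a finite product of conjugates of `g` and `g⁻¹`. -/
def IsProductOfConjugates {G : Type*} [Group G] (g f : G) : Prop :=
  ∃ l : List G, (∀ k ∈ l, IsConj g k ∨ IsConj g⁻¹ k) ∧ f = l.prod

end LinExp

namespace LinExp

open Structure

/-! ### Automorphisms as order-preserving permutations -/

section Automorphism

variable {L : FirstOrder.Language.{u, v}} {N : Type w} [L.Structure N]

/-! Strong amalgamation lets a new point be added independently of the order: over a finite set `B`,
the orbit of any `x ∉ B` under the pointwise stabilizer of `B` meets every interval that the order
does not forbid (`orbit_dense`). So a finite partial automorphism extends to a new point, in its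
domain or its range, with great freedom of place, and back and forth (`exists_generic`) yields
automorphisms meeting countably many requirements.

If `g` moves points up cofinally and coinitially, some conjugate of it carries `l i` beyond `r i`
for all `i ∈ ℤ`, for prescribed separated intervals running through the whole order
(`exists_conj_jump`). One conjugate is not controlled in the gaps between these intervals, so a
second one jumps over the gaps. Along a strictly increasing unbounded sequence the product then
sends each term past the next, which forces a single `+`-orbital; the inverse has a single
`-`-orbital.

An unbounded `g` need not move points up at both ends. Passing to `g⁻¹` secures the upper end; if
points then move only down near the lower end, a suitable commutator moves points up at both
(`exists_commutator_pos`). Everything stays in the normal closure of `g`. -/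

@[simp] theorem aut_one_apply (x : N) : (1 : N ≃[L] N) x = x := rfl

@[simp] theorem aut_mul_apply (g h : N ≃[L] N) (x : N) : (g * h) x = g (h x) := rfl

@[simp] theorem aut_inv_apply_self (g : N ≃[L] N) (x : N) : g⁻¹ (g x) = x :=
  g.symm_apply_apply x

@[simp] theorem aut_apply_inv_self (g : N ≃[L] N) (x : N) : g (g⁻¹ x) = x :=
  g.apply_symm_apply x

@[simp] theorem aut_lt_iff [L.IsOrdered] [LinearOrder N] [L.OrderedStructure N] (g : N ≃[L] N)
    (x y : N) : g x < g y ↔ x < y :=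
  (HomClass.strictMono (L := L) g).lt_iff_lt

@[simp] theorem aut_le_iff [L.IsOrdered] [LinearOrder N] [L.OrderedStructure N] (g : N ≃[L] N)
    (x y : N) : g x ≤ g y ↔ x ≤ y :=
  (HomClass.strictMono (L := L) g).le_iff_le

end Automorphism

/-! ### Homogeneity for finite families in a relational language -/

section Relational

variable {L : FirstOrder.Language.{u, v}} [L.IsRelational]

/-- The structure in a relational language induced along a map. -/
@[reducible] def comapStructure (L : FirstOrder.Language.{u, v}) [L.IsRelational]
    {T N : Type*} [L.Structure N] (f : T → N) : L.Structure T where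
  funMap c := isEmptyElim c
  RelMap r xs := RelMap r (f ∘ xs)

/-- An injective map which preserves and reflects relations, as an embedding of structures. -/
def embeddingOfRelMapIff {T N : Type*} [L.Structure T] [L.Structure N] (f : T → N)
    (hf : Function.Injective f)
    (h : ∀ {n} (r : L.Relations n) (xs : Fin n → T), RelMap r (f ∘ xs) ↔ RelMap r xs) :
    T ↪[L] N where
  toFun := f
  inj' := hf
  map_fun' c := isEmptyElim c
  map_rel' r xs := h r xs

theorem exists_equiv_of_relMap_iff {N : Type w} [L.Structure N] (hN : L.IsUltrahomogeneous N)
    {T : Type*} [Finite T] (u v : T → N) (hu : Function.Injective u) (hv : Function.Injective v)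
    (h : ∀ {n} (r : L.Relations n) (xs : Fin n → T), RelMap r (u ∘ xs) ↔ RelMap r (v ∘ xs)) :
    ∃ σ : N ≃[L] N, ∀ t, σ (u t) = v t := by
  let := comapStructure L u
  let eu : T ↪[L] N := embeddingOfRelMapIff u hu fun _ _ => Iff.rfl
  let ev : T ↪[L] N := embeddingOfRelMapIff v hv fun r xs => (h r xs).symm
  obtain ⟨σ, hσ⟩ := hN eu.toHom.range (FG.range FG.of_finite _)
    (ev.comp eu.equivRange.symm.toEmbedding)
  refine ⟨σ, fun t => ?_⟩
  have h₁ := DFunLike.congr_fun hσ (eu.equivRange t)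
  have h₂ : ev (eu.equivRange.symm (eu.equivRange t)) = σ (u t) := h₁
  rw [FirstOrder.Language.Equiv.symm_apply_apply] at h₂
  exact h₂.symm

end Relational

/-! ### Density of orbits from strong amalgamation -/

section Expansion

variable {L : FirstOrder.Language.{u, v}} [L.IsRelational]
  {M : Type w} [L.Structure M]
  {N : Type w} [(L.sum Language.order).Structure N] [LinearOrder N]
  [(L.sum Language.order).OrderedStructure N]

/-- A relation symbol of `L` as a symbol of the ordered language. -/
abbrev inlRel {n : ℕ} (r : L.Relations n) : (L.sum Language.order).Relations n := Sum.inl r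

omit [L.IsRelational] in
theorem relMap_sum_iff {T N₁ N₂ : Type*} [(L.sum Language.order).Structure N₁] [LinearOrder N₁]
    [(L.sum Language.order).OrderedStructure N₁]
    [(L.sum Language.order).Structure N₂] [LinearOrder N₂]
    [(L.sum Language.order).OrderedStructure N₂] (u : T → N₁) (v : T → N₂)
    (hle : ∀ s t, u s ≤ u t ↔ v s ≤ v t)
    (hrel : ∀ {n} (r : L.Relations n) (xs : Fin n → T),
      RelMap (inlRel r) (u ∘ xs) ↔
        RelMap (inlRel r) (v ∘ xs))
    {n : ℕ} (r : (L.sum Language.order).Relations n) (xs : Fin n → T) :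
    RelMap r (u ∘ xs) ↔ RelMap r (v ∘ xs) := by
  cases r with
  | inl r => exact hrel r xs
  | inr r =>
    cases r
    have h₁ := relMap_leSymb (L := L.sum Language.order) (u ∘ xs)
    have h₂ := relMap_leSymb (L := L.sum Language.order) (v ∘ xs)
    exact h₁.trans ((hle _ _).trans h₂.symm)

/-- A finite `L`-structure embeddable in `M`, equipped with any linear order, embeds in the
linear order expansion. -/
theorem exists_embedding_of_age
    (hage : (L.sum Language.order).age N = orderExpansionClass (L.age M))
    {T : Type w} [Finite T] {X : Type*} [LinearOrder X] (key : T → X)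
    (hkey : Function.Injective key) (ι : T → M) (hι : Function.Injective ι) :
    ∃ τ : T → N, (∀ s t, τ s ≤ τ t ↔ key s ≤ key t) ∧
      ∀ {n} (r : L.Relations n) (xs : Fin n → T),
        RelMap (inlRel r) (τ ∘ xs) ↔
          RelMap r (ι ∘ xs) := by
  let _ : LinearOrder T := LinearOrder.lift' key hkey
  let iL : L.Structure T := comapStructure L ι
  let : Language.order.Structure T := orderStructure T
  have : (L.sum Language.order).OrderedStructure T := ⟨fun _ => Iff.rfl⟩
  have hmem : (⟨T, inferInstance⟩ : Bundled.{w} (L.sum Language.order).Structure) ∈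
      (L.sum Language.order).age N := by
    rw [hage]
    refine ⟨⟨FG.of_finite, ⟨?_⟩⟩, ?_⟩
    · let : L.Structure T := (LHom.sumInl : L →ᴸ L.sum Language.order).reduct T
      exact embeddingOfRelMapIff ι hι fun _ _ => Iff.rfl
    · exact model_linearOrder (L := L.sum Language.order) (M := T)
  obtain ⟨-, ⟨τ⟩⟩ := hmem
  refine ⟨τ, fun s t => ?_, fun r xs => ?_⟩
  · have := τ.map_rel (leSymb : (L.sum Language.order).Relations 2) ![s, t]
    rw [relMap_leSymb, relMap_leSymb] at this
    exact this
  · exact τ.map_rel (inlRel r) xs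

/-- The `L`-structure induced on a finite type mapped injectively to the expansion. -/
@[reducible] def comapReduct {T : Type*} (f : T → N) : L.Structure T :=
  let := (LHom.sumInl : L →ᴸ L.sum Language.order).reduct N
  comapStructure L f

omit [LinearOrder N] [(L.sum Language.order).OrderedStructure N] in
theorem comapReduct_mem_age
    (hage : (L.sum Language.order).age N = orderExpansionClass (L.age M))
    {T : Type w} [Finite T] (f : T → N) (hf : Function.Injective f) :
    (⟨T, comapReduct f⟩ : Bundled.{w} L.Structure) ∈ L.age M := by
  let := comapStructure (L.sum Language.order) f
  have hmem : (⟨T, inferInstance⟩ : Bundled.{w} (L.sum Language.order).Structure) ∈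
      (L.sum Language.order).age N :=
    ⟨FG.of_finite, ⟨embeddingOfRelMapIff f hf fun _ _ => Iff.rfl⟩⟩
  rw [hage] at hmem
  obtain ⟨-, ⟨e⟩⟩ := hmem.1
  let := comapReduct (L := L) f
  exact ⟨FG.of_finite, ⟨embeddingOfRelMapIff e e.injective fun r xs => e.map_rel r xs⟩⟩

theorem nonempty_of_age
    (hage : (L.sum Language.order).age N = orderExpansionClass (L.age M)) [Nonempty M] :
    Nonempty N := by
  obtain ⟨m⟩ := ‹Nonempty M›
  obtain ⟨τ, -⟩ := exists_embedding_of_age hage (T := PUnit) (fun _ => (0 : ℕ))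
    (Function.injective_of_subsingleton _) (fun _ => m)
    (Function.injective_of_subsingleton _)
  exact ⟨τ PUnit.unit⟩

/-- Amalgamate `B ∪ {x}` and `B ∪ {p, q}` strongly over `B`. The copy of `x` is a new point, even if
`x` is `p` or `q`, and any linear order on the amalgam is admissible, so the copy may be placed
between `p` and `q`. After embedding the result in `N`, homogeneity matches both pieces with their
copies, by `ρ₂` and `ρ`; then `ρ⁻¹ * ρ₂` is the required automorphism. -/
theorem orbit_dense (hK : StrongAmalgamation (L.age M))
    (hage : (L.sum Language.order).age N = orderExpansionClass (L.age M))
    (hN : (L.sum Language.order).IsUltrahomogeneous N)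
    (B : Finset N) {x p q : N} (hx : x ∉ B) (hpq : p < q)
    (hq : ∀ b ∈ B, b < x → b < q) (hp : ∀ b ∈ B, x < b → p < b) :
    ∃ σ : N ≃[L.sum Language.order] N, (∀ b ∈ B, σ b = b) ∧ p < σ x ∧ σ x < q := by
  classical
  let E₁ := {z : N // z ∈ insert x B}
  let E₂ := {z : N // z ∈ insert p (insert q B)}
  let E₀ := {z : N // z ∈ B}
  let i₁ : L.Structure E₁ := comapReduct Subtype.val
  let i₂ : L.Structure E₂ := comapReduct Subtype.val
  let i₀ : L.Structure E₀ := comapReduct Subtype.val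
  let f₁ : E₀ ↪[L] E₁ := embeddingOfRelMapIff (fun b => ⟨b.1, by simp [b.2]⟩)
    (fun a b h => Subtype.ext (congrArg Subtype.val h :)) fun _ _ => Iff.rfl
  let f₂ : E₀ ↪[L] E₂ := embeddingOfRelMapIff (fun b => ⟨b.1, by simp [b.2]⟩)
    (fun a b h => Subtype.ext (congrArg Subtype.val h :)) fun _ _ => Iff.rfl
  obtain ⟨D, d₁, d₂, ⟨-, ⟨j⟩⟩, hcomm, hrange⟩ := hK ⟨E₀, i₀⟩ ⟨E₁, i₁⟩ ⟨E₂, i₂⟩ f₁ f₂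
    (comapReduct_mem_age hage _ Subtype.val_injective)
    (comapReduct_mem_age hage _ Subtype.val_injective)
    (comapReduct_mem_age hage _ Subtype.val_injective)
  let x₁ : E₁ := ⟨x, by simp⟩
  -- Here strongness is used: a coincidence would lie in the image of `B`, forcing `x ∈ B`.
  have hd : ∀ e, d₂ e ≠ d₁ x₁ := by
    intro e he
    have : d₁ x₁ ∈ Set.range d₁ ∩ Set.range d₂ := ⟨⟨_, rfl⟩, e, he⟩
    rw [hrange] at this
    obtain ⟨b, hb⟩ := this
    have : f₁ b = x₁ := d₁.injective hb
    have hbx : b.1 = x := congrArg Subtype.val this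
    exact hx (hbx ▸ b.2)
  have hcomm' : ∀ b, d₁ (f₁ b) = d₂ (f₂ b) := fun b => DFunLike.congr_fun hcomm b
  let ι : Option E₂ → M := fun t => t.elim (j (d₁ x₁)) fun e => j (d₂ e)
  have hι : Function.Injective ι := by
    rintro (_ | a) (_ | b) h
    · rfl
    · exact (hd b (j.injective h).symm).elim
    · exact (hd a (j.injective h)).elim
    · exact congrArg some (d₂.injective (j.injective h))
  -- The place of the new point: immediately after `m`.
  obtain ⟨m, hmp, hmx, hmq, hmb⟩ : ∃ m : N, p ≤ m ∧ (∀ b ∈ B, b < x → b ≤ m) ∧ m < q ∧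
      ∀ b ∈ B, x < b → m < b := by
    let S := insert p (B.filter (· < x))
    have hS : S.Nonempty := Finset.insert_nonempty _ _
    have hm := S.max'_mem hS
    refine ⟨S.max' hS, S.le_max' _ (by simp [S]), fun b hb hbx => S.le_max' _ (by simp [S, hb, hbx]),
      ?_, fun b hb hbx => ?_⟩
    · rcases Finset.mem_insert.1 hm with h | h
      · rwa [h]
      · rw [Finset.mem_filter] at h
        exact hq _ h.1 h.2
    · rcases Finset.mem_insert.1 hm with h | h
      · rw [h]; exact hp b hb hbx
      · rw [Finset.mem_filter] at h
        exact h.2.trans hbx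
  -- The second coordinate creates room just above `m` without assuming that `N` is dense.
  let key : Option E₂ → N ×ₗ ℕ := fun t => t.elim (toLex (m, 1)) fun e => toLex (e.1, 0)
  have hkey : Function.Injective key := by
    rintro (_ | a) (_ | b) h
    · rfl
    · simp [key] at h
    · simp [key] at h
    · have := congrArg Prod.fst (toLex.injective h)
      exact congrArg some (Subtype.ext this)
  have hsome : ∀ a b : E₂, key (some a) ≤ key (some b) ↔ a.1 ≤ b.1 := by
    intro a b
    rw [show key (some a) = toLex (a.1, 0) from rfl, show key (some b) = toLex (b.1, 0) from rfl,
      Prod.Lex.toLex_le_toLex]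
    simp [le_iff_lt_or_eq]
  have hlt_none : ∀ a : E₂, key (some a) < key none ↔ a.1 ≤ m := by
    intro a
    simp [key, Prod.Lex.toLex_lt_toLex, le_iff_lt_or_eq]
  have hnone_lt : ∀ a : E₂, key none < key (some a) ↔ m < a.1 := by
    intro a
    simp [key, Prod.Lex.toLex_lt_toLex]
  obtain ⟨τ, hτ, hτr⟩ := exists_embedding_of_age hage key hkey ι hι
  have hτlt : ∀ s t, τ s < τ t ↔ key s < key t := fun s t => by
    rw [← not_le, ← not_le, hτ]
  have hτi : Function.Injective τ := fun s t h =>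
    hkey (le_antisymm ((hτ s t).1 h.le) ((hτ t s).1 h.ge))
  obtain ⟨ρ, hρ⟩ := exists_equiv_of_relMap_iff hN (fun e : E₂ => e.1) (fun e => τ (some e))
    Subtype.val_injective (fun a b h => Option.some_injective _ (hτi h))
    (relMap_sum_iff _ _ (fun s t => by rw [hτ, hsome]) fun r xs => by
      have h₁ := hτr r (some ∘ xs)
      have h₂ := j.map_rel r (d₂ ∘ xs)
      have h₃ := d₂.map_rel r xs
      exact (h₁.trans (h₂.trans h₃)).symm)
  let f₃ : E₁ → Option E₂ := fun e => if h : e.1 ∈ B then some (f₂ ⟨e.1, h⟩) else none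
  have hf₃ : ∀ e, ι (f₃ e) = j (d₁ e) := by
    intro e
    by_cases h : e.1 ∈ B
    · simp only [f₃, dif_pos h, ι, Option.elim]
      rw [← hcomm']
      rfl
    · simp only [f₃, dif_neg h, ι, Option.elim]
      obtain h' | h' := Finset.mem_insert.1 e.2
      · congr 2
        exact Subtype.ext h'.symm
      · exact (h h').elim
  have hf₃x : f₃ x₁ = none := dif_neg hx
  have hf₃b : ∀ (b : N) (hb : b ∈ B), f₃ ⟨b, by simp [hb]⟩ = some (f₂ ⟨b, hb⟩) :=
    fun b hb => dif_pos hb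
  have hf₃i : Function.Injective f₃ := fun a b h =>
    d₁.injective (j.injective (by rw [← hf₃, ← hf₃, h]))
  have hf₃lt : ∀ s t : E₁, s.1 < t.1 → key (f₃ s) < key (f₃ t) := by
    rintro ⟨s, hs⟩ ⟨t, ht⟩ (hst : s < t)
    by_cases hs' : s ∈ B <;> by_cases ht' : t ∈ B
    · rw [hf₃b s hs', hf₃b t ht', lt_iff_le_not_ge, hsome, hsome]
      exact ⟨hst.le, not_le.2 hst⟩
    · obtain rfl : t = x := by simpa [ht'] using ht
      rw [hf₃b s hs', show f₃ ⟨t, ht⟩ = none from hf₃x, hlt_none]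
      exact hmx s hs' hst
    · obtain rfl : s = x := by simpa [hs'] using hs
      rw [hf₃b t ht', show f₃ ⟨s, hs⟩ = none from hf₃x, hnone_lt]
      exact hmb t ht' hst
    · obtain rfl : t = x := by simpa [ht'] using ht
      obtain rfl : s = t := by simpa [hs'] using hs
      exact (lt_irrefl _ hst).elim
  obtain ⟨ρ₂, hρ₂⟩ := exists_equiv_of_relMap_iff hN (fun e : E₁ => e.1) (fun e => τ (f₃ e))
    Subtype.val_injective (fun a b h => hf₃i (hτi h))
    (relMap_sum_iff _ _ (fun s t => by
        rw [hτ]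
        refine ⟨fun h => ?_, fun h => ?_⟩
        · obtain h | h := h.lt_or_eq
          · exact (hf₃lt _ _ h).le
          · rw [Subtype.ext h]
        · by_contra h'
          exact (hf₃lt _ _ (not_le.1 h')).not_ge h) fun r xs => by
      have h₁ := hτr r (f₃ ∘ xs)
      have h₂ := j.map_rel r (d₁ ∘ xs)
      have h₃ := d₁.map_rel r xs
      have h₄ : ι ∘ f₃ ∘ xs = j ∘ d₁ ∘ xs := funext fun i => hf₃ _
      rw [h₄] at h₁
      exact (h₁.trans (h₂.trans h₃)).symm)
  have hlt : ∀ a b : N, ρ a < ρ b ↔ a < b := aut_lt_iff ρ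
  refine ⟨ρ⁻¹ * ρ₂, fun b hb => ?_, ?_, ?_⟩
  · change ρ⁻¹ (ρ₂ b) = b
    rw [show ρ₂ b = ρ b from ?_, aut_inv_apply_self]
    have h₁ := hρ₂ ⟨b, by simp [hb]⟩
    have h₂ := hρ (f₂ ⟨b, hb⟩)
    rw [hf₃b b hb] at h₁
    exact h₁.trans h₂.symm
  · have h₁ : ρ₂ x = τ none := (hρ₂ x₁).trans (by rw [hf₃x])
    have h₂ : ρ p = _ := hρ ⟨p, by simp⟩
    rw [← hlt]
    change _ < ρ (ρ⁻¹ (ρ₂ x))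
    rw [aut_apply_inv_self, h₁, h₂, hτlt, hlt_none]
    exact hmp
  · have h₁ : ρ₂ x = τ none := (hρ₂ x₁).trans (by rw [hf₃x])
    have h₂ : ρ q = _ := hρ ⟨q, by simp⟩
    rw [← hlt]
    change ρ (ρ⁻¹ (ρ₂ x)) < _
    rw [aut_apply_inv_self, h₁, h₂, hτlt, hnone_lt]
    exact hmq

end Expansion

/-! ### Back and forth with requirements -/

section BackAndForth

/-- Realizations of non-algebraic types over finite sets are dense in the cuts of their order
types: orbits of pointwise stabilizers of finite sets meet all open intervals which the order
does not forbid. -/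
def HasDenseOrbits (L : FirstOrder.Language.{u, v}) (N : Type w) [L.Structure N]
    [LinearOrder N] : Prop :=
  ∀ (B : Finset N) (x p q : N), x ∉ B → p < q → (∀ b ∈ B, b < x → b < q) →
    (∀ b ∈ B, x < b → p < b) → ∃ σ : N ≃[L] N, (∀ b ∈ B, σ b = b) ∧ p < σ x ∧ σ x < q

variable {L : FirstOrder.Language.{u, v}} {N : Type w} [L.Structure N]

/-- A finite approximation to an automorphism: a finite set together with an automorphism, of
which only the restriction to the finite set matters. -/
abbrev Approx (L : FirstOrder.Language.{u, v}) (N : Type w) [L.Structure N] :=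
  Finset N × (N ≃[L] N)

/-- The approximation `D` extends `C`. -/
def Extends (C D : Approx L N) : Prop := C.1 ⊆ D.1 ∧ ∀ a ∈ C.1, D.2 a = C.2 a

theorem Extends.refl (C : Approx L N) : Extends C C := ⟨Finset.Subset.refl _, fun _ _ => rfl⟩

theorem Extends.trans {C D E : Approx L N} (h₁ : Extends C D) (h₂ : Extends D E) : Extends C E :=
  ⟨h₁.1.trans h₂.1, fun a ha => (h₂.2 a (h₁.1 ha)).trans (h₁.2 a ha)⟩

theorem extends_insert [DecidableEq N] (A : Finset N) (H : N ≃[L] N) (x : N) :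
    Extends (A, H) (insert x A, H) :=
  ⟨Finset.subset_insert _ _, fun _ _ => rfl⟩

/-- A coherent sequence of approximations with exhausting domains and ranges has a limit. -/
theorem exists_limit [L.IsRelational] (C : ℕ → Approx L N)
    (hC : ∀ k, Extends (C k) (C (k + 1)))
    (hdom : ∀ x, ∃ k, x ∈ (C k).1) (hran : ∀ x, ∃ k, ∃ a ∈ (C k).1, (C k).2 a = x) :
    ∃ h : N ≃[L] N, ∀ k, ∀ a ∈ (C k).1, h a = (C k).2 a := by
  have hmono : ∀ {i j}, i ≤ j → Extends (C i) (C j) := by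
    intro i j hij
    induction hij with
    | refl => exact Extends.refl _
    | step _ ih => exact ih.trans (hC _)
  choose κ hκ using hdom
  let f : N → N := fun x => (C (κ x)).2 x
  have hf : ∀ k, ∀ a ∈ (C k).1, f a = (C k).2 a := by
    intro k a ha
    rcases le_total k (κ a) with h | h
    · exact (hmono h).2 a ha
    · exact ((hmono h).2 a (hκ a)).symm
  have hcommon : ∀ {n} (xs : Fin n → N), ∃ k, ∀ i, xs i ∈ (C k).1 := by
    intro n xs
    refine ⟨Finset.univ.sup fun i => κ (xs i), fun i => ?_⟩
    exact (hmono (Finset.le_sup (f := fun i => κ (xs i)) (Finset.mem_univ i))).1 (hκ _)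
  have hinj : Function.Injective f := by
    intro a b hab
    obtain ⟨k, hk⟩ := hcommon ![a, b]
    rw [hf k a (hk 0), hf k b (hk 1)] at hab
    exact (C k).2.injective hab
  have hsurj : Function.Surjective f := by
    intro x
    obtain ⟨k, a, ha, hax⟩ := hran x
    exact ⟨a, (hf k a ha).trans hax⟩
  refine ⟨⟨_root_.Equiv.ofBijective f ⟨hinj, hsurj⟩, fun c => isEmptyElim c, fun r xs => ?_⟩, hf⟩
  obtain ⟨k, hk⟩ := hcommon xs
  have : f ∘ xs = (C k).2 ∘ xs := funext fun i => hf k _ (hk i)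
  change RelMap r (f ∘ xs) ↔ _
  rw [this]
  exact (C k).2.map_rel r xs

/-- Back and forth: countably many requirements, each of which can be met by extending any given
approximation satisfying `P`, can be met by approximations to a single automorphism. -/
theorem exists_generic [L.IsRelational] [Countable N] {ι : Type*} [Countable ι]
    (P : Approx L N → Prop) (R : ι → Approx L N → Prop) (C₀ : Approx L N) (h₀ : P C₀)
    (hdom : ∀ x C, P C → ∃ D, Extends C D ∧ P D ∧ x ∈ D.1)
    (hran : ∀ x C, P C → ∃ D, Extends C D ∧ P D ∧ ∃ a ∈ D.1, D.2 a = x)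
    (hR : ∀ i C, P C → ∃ D, Extends C D ∧ P D ∧ R i D) :
    ∃ h : N ≃[L] N, ∀ i, ∃ C, P C ∧ R i C ∧ ∀ a ∈ C.1, h a = C.2 a := by
  classical
  -- The vacuous `Unit` requirement makes the index type nonempty, as its enumeration by `ℕ` needs.
  let Q : Unit ⊕ (N ⊕ N) ⊕ ι → Approx L N → Prop := Sum.elim (fun _ _ => True)
    (Sum.elim (Sum.elim (fun x D => x ∈ D.1) (fun x D => ∃ a ∈ D.1, D.2 a = x)) R)
  have hQ : ∀ q C, P C → ∃ D, Extends C D ∧ P D ∧ Q q D := by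
    rintro (_ | (x | x) | i) C hC
    · exact ⟨C, Extends.refl _, hC, trivial⟩
    · exact hdom x C hC
    · exact hran x C hC
    · exact hR i C hC
  obtain ⟨e, he⟩ := exists_surjective_nat (Unit ⊕ (N ⊕ N) ⊕ ι)
  choose! next hnext hP hQn using hQ
  let C : ℕ → Approx L N := fun n => Nat.rec C₀ (fun k D => next (e k) D) n
  have hPC : ∀ n, P (C n) := by
    intro n
    induction n with
    | zero => exact h₀
    | succ n ih => exact hP _ _ ih
  have hQC : ∀ q, ∃ n, Q q (C n) := by
    intro q
    obtain ⟨n, rfl⟩ := he q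
    exact ⟨n + 1, hQn _ _ (hPC n)⟩
  obtain ⟨h, hh⟩ := exists_limit C (fun k => hnext _ _ (hPC k))
    (fun x => hQC (.inr (.inl (.inl x)))) (fun x => hQC (.inr (.inl (.inr x))))
  refine ⟨h, fun i => ?_⟩
  obtain ⟨n, hn⟩ := hQC (.inr (.inr i))
  exact ⟨C n, hPC n, hn, hh n⟩

variable [L.IsOrdered] [LinearOrder N] [L.OrderedStructure N]

theorem HasDenseOrbits.exists_extends_apply [DecidableEq N] (hD : HasDenseOrbits L N) (A : Finset N)
    (H : N ≃[L] N) {y p q : N} (hy : y ∉ A) (hpq : p < q) (hq : ∀ a ∈ A, a < y → H a < q)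
    (hp : ∀ a ∈ A, y < a → p < H a) :
    ∃ H' : N ≃[L] N, Extends (A, H) (insert y A, H') ∧ p < H' y ∧ H' y < q := by
  obtain ⟨σ, hσ, h₁, h₂⟩ := hD (A.image H) (H y) p q
    (by simpa using hy) hpq
    (by simpa using hq) (by simpa using hp)
  refine ⟨σ * H, ⟨Finset.subset_insert _ _, fun a ha => ?_⟩, h₁, h₂⟩
  exact hσ _ (Finset.mem_image_of_mem _ ha)

/-- Density is applied on the domain side: `σ` fixes `A` and moves the current preimage `H⁻¹ x` into
`(p, q)`, and `H * σ⁻¹` absorbs the change. -/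
theorem HasDenseOrbits.exists_extends_preimage [DecidableEq N] (hD : HasDenseOrbits L N)
    (A : Finset N) (H : N ≃[L] N) {x p q : N} (hx : ∀ a ∈ A, H a ≠ x) (hpq : p < q)
    (hq : ∀ a ∈ A, H a < x → a < q) (hp : ∀ a ∈ A, x < H a → p < a) :
    ∃ (y : N) (H' : N ≃[L] N), Extends (A, H) (insert y A, H') ∧ H' y = x ∧ p < y ∧ y < q := by
  obtain ⟨σ, hσ, h₁, h₂⟩ := hD A (H⁻¹ x) p q
    (fun h => hx _ h (by simp)) hpq
    (fun a ha h => hq a ha (by simpa using (aut_lt_iff H _ _).2 h))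
    (fun a ha h => hp a ha (by simpa using (aut_lt_iff H _ _).2 h))
  refine ⟨σ (H⁻¹ x), H * σ⁻¹, ⟨Finset.subset_insert _ _, fun a ha => ?_⟩, ?_, h₁, h₂⟩
  · change H (σ⁻¹ a) = H a
    conv_lhs => rw [← hσ a ha]
    simp
  · simp

omit [L.IsOrdered] [L.OrderedStructure N] in
theorem HasDenseOrbits.exists_between (hD : HasDenseOrbits L N) {p q : N} (hpq : p < q) :
    ∃ x, p < x ∧ x < q := by
  obtain ⟨σ, -, h⟩ := hD ∅ p p q (by simp) hpq (by simp) (by simp)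
  exact ⟨_, h⟩

end BackAndForth

/-! ### Conjugates with prescribed jumps, and commutators -/

section Jumps

variable {L : FirstOrder.Language.{u, v}} [L.IsRelational] {N : Type w} [L.Structure N]
  [Countable N] [L.IsOrdered] [LinearOrder N] [L.OrderedStructure N]

theorem exists_forall_le {N : Type*} [LinearOrder N] [Nonempty N] (A : Finset N) :
    ∃ c, ∀ a ∈ A, c ≤ a :=
  Finset.exists_le (α := Nᵒᵈ) A

/-- The window `(p m, p n)` of an approximation `C` to `h`: its range lies in the window, and for
`m ≤ i < n` it guarantees that `h * g * h⁻¹` maps a point below `l i` to a point above `r i`. -/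
def Window (g : N ≃[L] N) (p l r : ℤ → N) (m n : ℤ) (C : Approx L N) : Prop :=
  m ≤ n ∧ (∀ a ∈ C.1, p m < C.2 a ∧ C.2 a < p n) ∧
    ∀ i, m ≤ i → i < n → ∃ b ∈ C.1, g b ∈ C.1 ∧ C.2 b < l i ∧ r i < C.2 (g b)

section Window

variable {g : N ≃[L] N} {p l r : ℤ → N}

omit [L.IsRelational] [Countable N] in
-- If `z < g z`, every point of `(z, g z)` is moved up too, so there is a whole interval above `A`
-- from which to choose a preimage `b` of a point just below `l n`. Then `g b` exceeds `b` and all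
-- of `A`, so its image may be put beyond `r n`.
theorem Window.exists_succ (hD : HasDenseOrbits L N) (hg : ∀ c, ∃ z, c < z ∧ z < g z)
    (hpl : ∀ i, p i < l i) (hlr : ∀ i, l i < r i) (hrp : ∀ i, r i < p (i + 1))
    {m n : ℤ} {C : Approx L N} (hC : Window g p l r m n C) :
    ∃ D, Extends C D ∧ Window g p l r m (n + 1) D := by
  classical
  obtain ⟨A, H⟩ := C
  obtain ⟨hmn, hA, htask⟩ := hC
  have : Nonempty N := ⟨p 0⟩
  have hpm : StrictMono p :=
    strictMono_int_of_lt_succ fun i => (hpl i).trans ((hlr i).trans (hrp i))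
  obtain ⟨c, hc⟩ := A.exists_le
  obtain ⟨z, hcz, hz⟩ := hg c
  obtain ⟨α, hα₁, hα₂⟩ := hD.exists_between (hpl n)
  obtain ⟨b, H₁, hH₁, hb, hzb, hbg⟩ := hD.exists_extends_preimage A H (x := α)
    (fun a ha h => (h ▸ (hA a ha).2).not_gt hα₁) hz
    (fun a ha _ => (hc a ha).trans_lt (hcz.trans hz))
    (fun a ha h => ((hα₁.trans h).trans (hA a ha).2).false.elim)
  have hbgb : b < g b := hbg.trans ((aut_lt_iff g _ _).2 hzb)
  have hlt : ∀ a ∈ insert b A, a < g b := by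
    intro a ha
    rcases Finset.mem_insert.1 ha with rfl | ha
    · exact hbgb
    · exact ((hc a ha).trans_lt (hcz.trans hzb)).trans hbgb
  have hH₁A : ∀ a ∈ A, H₁ a = H a := hH₁.2
  have hH₁lt : ∀ a ∈ insert b A, p m < H₁ a ∧ H₁ a < p (n + 1) := by
    intro a ha
    rcases Finset.mem_insert.1 ha with rfl | ha
    · rw [hb]
      exact ⟨(hpm.monotone hmn).trans_lt hα₁, hα₂.trans ((hlr n).trans (hrp n))⟩
    · rw [hH₁A a ha]
      exact ⟨(hA a ha).1, (hA a ha).2.trans (hpm (lt_add_one n))⟩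
  obtain ⟨H₂, hH₂, hr, hp⟩ := hD.exists_extends_apply (insert b A) H₁ (y := g b)
    (fun h => (hlt _ h).false) (hrp n) (fun a ha _ => (hH₁lt a ha).2)
    (fun a ha h => ((hlt a ha).trans h).false.elim)
  refine ⟨_, hH₁.trans hH₂, by omega, ?_, ?_⟩
  · intro a ha
    rcases Finset.mem_insert.1 ha with rfl | ha
    · exact ⟨((hpm.monotone hmn).trans_lt ((hpl n).trans (hlr n))).trans hr, hp⟩
    · have : H₂ a = H₁ a := hH₂.2 a ha
      rw [this]
      exact hH₁lt a ha
  · intro i hmi hin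
    rcases (Int.lt_add_one_iff.1 hin).lt_or_eq with hin | rfl
    · obtain ⟨b', hb', hgb', h₁, h₂⟩ := htask i hmi hin
      refine ⟨b', (hH₁.trans hH₂).1 hb', (hH₁.trans hH₂).1 hgb', ?_, ?_⟩
      · rwa [(hH₁.trans hH₂).2 _ hb']
      · rwa [(hH₁.trans hH₂).2 _ hgb']
    · refine ⟨b, by simp, by simp, ?_, hr⟩
      have : H₂ b = H₁ b := hH₂.2 b (by simp)
      rw [this, hb]
      exact hα₂

omit [L.IsRelational] [Countable N] in
-- The choices are made in the opposite order: the upper end `b` of the jump is placed first, after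
-- which `g⁻¹ b` lies below everything and may be sent below `l (m - 1)`.
theorem Window.exists_pred (hD : HasDenseOrbits L N) (hg : ∀ c, ∃ z, z < c ∧ z < g z)
    (hpl : ∀ i, p i < l i) (hlr : ∀ i, l i < r i) (hrp : ∀ i, r i < p (i + 1))
    {m n : ℤ} {C : Approx L N} (hC : Window g p l r m n C) :
    ∃ D, Extends C D ∧ Window g p l r (m - 1) n D := by
  classical
  obtain ⟨A, H⟩ := C
  obtain ⟨hmn, hA, htask⟩ := hC
  have : Nonempty N := ⟨p 0⟩
  have hpm : StrictMono p :=
    strictMono_int_of_lt_succ fun i => (hpl i).trans ((hlr i).trans (hrp i))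
  have hrm : r (m - 1) < p m := by simpa using hrp (m - 1)
  obtain ⟨c, hc⟩ := exists_forall_le A
  -- Starting below `g⁻¹ c` rather than `c` puts all of `(z, g z)` below `A`.
  obtain ⟨z, hcz, hz⟩ := hg (g⁻¹ c)
  have hgz : g z < c := by simpa using (aut_lt_iff g _ _).2 hcz
  obtain ⟨β, hβ₁, hβ₂⟩ := hD.exists_between hrm
  obtain ⟨b, H₁, hH₁, hb, hzb, hbg⟩ := hD.exists_extends_preimage A H (x := β)
    (fun a ha h => (h ▸ (hA a ha).1).not_gt hβ₂) hz
    (fun a ha h => ((h.trans hβ₂).trans (hA a ha).1).false.elim)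
    (fun a ha _ => hz.trans (hgz.trans_le (hc a ha)))
  have hbgb : g⁻¹ b < b := by
    rw [← aut_lt_iff g, aut_apply_inv_self]
    exact hbg.trans ((aut_lt_iff g _ _).2 hzb)
  have hlt : ∀ a ∈ insert b A, g⁻¹ b < a := by
    intro a ha
    rcases Finset.mem_insert.1 ha with rfl | ha
    · exact hbgb
    · exact hbgb.trans (hbg.trans (hgz.trans_le (hc a ha)))
  have hH₁A : ∀ a ∈ A, H₁ a = H a := hH₁.2
  have hH₁lt : ∀ a ∈ insert b A, p (m - 1) < H₁ a ∧ H₁ a < p n := by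
    intro a ha
    rcases Finset.mem_insert.1 ha with rfl | ha
    · rw [hb]
      exact ⟨((hpl _).trans (hlr _)).trans hβ₁, hβ₂.trans_le (hpm.monotone hmn)⟩
    · rw [hH₁A a ha]
      exact ⟨(hpm (sub_one_lt m)).trans (hA a ha).1, (hA a ha).2⟩
  obtain ⟨H₂, hH₂, hp, hl⟩ := hD.exists_extends_apply (insert b A) H₁ (y := g⁻¹ b)
    (fun h => (hlt _ h).false) (hpl (m - 1))
    (fun a ha h => ((hlt a ha).trans h).false.elim)
    (fun a ha _ => (hH₁lt a ha).1)
  refine ⟨_, hH₁.trans hH₂, by omega, ?_, ?_⟩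
  · intro a ha
    rcases Finset.mem_insert.1 ha with rfl | ha
    · exact ⟨hp, (hl.trans ((hlr _).trans hrm)).trans_le (hpm.monotone hmn)⟩
    · have : H₂ a = H₁ a := hH₂.2 a ha
      rw [this]
      exact hH₁lt a ha
  · intro i hmi hin
    rcases hmi.lt_or_eq with hmi | rfl
    · obtain ⟨b', hb', hgb', h₁, h₂⟩ := htask i (by omega) hin
      refine ⟨b', (hH₁.trans hH₂).1 hb', (hH₁.trans hH₂).1 hgb', ?_, ?_⟩
      · rwa [(hH₁.trans hH₂).2 _ hb']
      · rwa [(hH₁.trans hH₂).2 _ hgb']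
    · refine ⟨g⁻¹ b, by simp, by simp, hl, ?_⟩
      have : H₂ b = H₁ b := hH₂.2 b (by simp)
      rw [aut_apply_inv_self, this, hb]
      exact hβ₁

omit [L.IsRelational] [Countable N] in
theorem Window.exists_extends (hD : HasDenseOrbits L N) (hgr : ∀ c, ∃ z, c < z ∧ z < g z)
    (hgl : ∀ c, ∃ z, z < c ∧ z < g z)
    (hpl : ∀ i, p i < l i) (hlr : ∀ i, l i < r i) (hrp : ∀ i, r i < p (i + 1))
    {m n : ℤ} {C : Approx L N} (hC : Window g p l r m n C) (k : ℕ) :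
    ∃ D, Extends C D ∧ Window g p l r (m - k) (n + k) D := by
  induction k with
  | zero => exact ⟨C, Extends.refl _, by simpa using hC⟩
  | succ k ih =>
    obtain ⟨D, hCD, hW⟩ := ih
    obtain ⟨E, hDE, hE⟩ := hW.exists_succ hD hgr hpl hlr hrp
    obtain ⟨F, hEF, hF⟩ := hE.exists_pred hD hgl hpl hlr hrp
    refine ⟨F, hCD.trans (hDE.trans hEF), ?_⟩
    convert! hF using 1 <;> push_cast <;> ring

/-- An automorphism moving cofinally and coinitially many points upwards has a conjugate which
moves `l i` above `r i`, for an arbitrary increasing unbounded sequence of intervals. -/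
theorem exists_conj_jump (hD : HasDenseOrbits L N) (hgr : ∀ c, ∃ z, c < z ∧ z < g z)
    (hgl : ∀ c, ∃ z, z < c ∧ z < g z)
    (hpl : ∀ i, p i < l i) (hlr : ∀ i, l i < r i) (hrp : ∀ i, r i < p (i + 1))
    (hcof : ∀ x, ∃ i, x < p i) (hcoi : ∀ x, ∃ i, p i < x) :
    ∃ h : N ≃[L] N, ∀ i, r i < (h * g * h⁻¹) (l i) := by
  classical
  have hpm : StrictMono p :=
    strictMono_int_of_lt_succ fun i => (hpl i).trans ((hlr i).trans (hrp i))
  let P : Approx L N → Prop := fun C => ∃ m n, Window g p l r m n C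
  let R : ℤ → Approx L N → Prop := fun i C => ∃ b ∈ C.1, g b ∈ C.1 ∧ C.2 b < l i ∧ r i < C.2 (g b)
  have hdom : ∀ x C, P C → ∃ D, Extends C D ∧ P D ∧ x ∈ D.1 := by
    rintro x C ⟨m, n, hC⟩
    -- One enlargement makes the window nondegenerate, even if `m = n`.
    obtain ⟨D, hCD, hDW⟩ := hC.exists_extends hD hgr hgl hpl hlr hrp 1
    by_cases hx : x ∈ D.1
    · exact ⟨D, hCD, ⟨_, _, hDW⟩, hx⟩
    obtain ⟨hmn, hA, htask⟩ := hDW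
    have := hC.1
    obtain ⟨H', hH', h₁, h₂⟩ := hD.exists_extends_apply D.1 D.2 hx
      (hpm (show m - (1 : ℕ) < n + (1 : ℕ) by push_cast; omega))
      (fun a ha _ => (hA a ha).2) (fun a ha _ => (hA a ha).1)
    have hH'D : ∀ a ∈ D.1, H' a = D.2 a := hH'.2
    refine ⟨_, hCD.trans hH', ⟨_, _, hmn, ?_, ?_⟩, by simp⟩
    · intro a ha
      rcases Finset.mem_insert.1 ha with rfl | ha
      · exact ⟨h₁, h₂⟩
      · change p _ < H' a ∧ H' a < p _
        rw [hH'D a ha]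
        exact hA a ha
    · intro i hi hi'
      obtain ⟨b, hb, hgb, h₃, h₄⟩ := htask i hi hi'
      refine ⟨b, hH'.1 hb, hH'.1 hgb, ?_, ?_⟩
      · rwa [hH'.2 _ hb]
      · rwa [hH'.2 _ hgb]
  have hran : ∀ x C, P C → ∃ D, Extends C D ∧ P D ∧ ∃ a ∈ D.1, D.2 a = x := by
    rintro x C ⟨m, n, hC⟩
    obtain ⟨i, hi⟩ := hcof x
    obtain ⟨j, hj⟩ := hcoi x
    -- Enlarge until the window contains `x`; adding the preimage of `x` is then harmless.
    obtain ⟨D, hCD, hmn, hA, htask⟩ :=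
      hC.exists_extends hD hgr hgl hpl hlr hrp ((i - n).toNat + (m - j).toNat)
    refine ⟨(insert (D.2⁻¹ x) D.1, D.2), hCD.trans (extends_insert _ _ _), ⟨_, _, hmn, ?_, ?_⟩,
      D.2⁻¹ x, by simp, by simp⟩
    · intro a ha
      rcases Finset.mem_insert.1 ha with rfl | ha
      · simp only [aut_apply_inv_self]
        exact ⟨(hpm.monotone (by omega)).trans_lt hj, hi.trans_le (hpm.monotone (by omega))⟩
      · exact hA a ha
    · intro k hk hk'
      obtain ⟨b, hb, hgb, h₃⟩ := htask k hk hk'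
      exact ⟨b, Finset.mem_insert_of_mem hb, Finset.mem_insert_of_mem hgb, h₃⟩
  have hR : ∀ i C, P C → ∃ D, Extends C D ∧ P D ∧ R i D := by
    rintro i C ⟨m, n, hC⟩
    obtain ⟨D, hCD, hDW⟩ :=
      hC.exists_extends hD hgr hgl hpl hlr hrp ((i - n).toNat + (m - i).toNat + 1)
    exact ⟨D, hCD, ⟨_, _, hDW⟩, hDW.2.2 i (by push_cast; omega) (by push_cast; omega)⟩
  obtain ⟨h, hh⟩ := exists_generic P R (∅, 1)
    ⟨0, 0, le_rfl, by simp, fun i h₁ h₂ => by omega⟩ hdom hran hR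
  refine ⟨h, fun i => ?_⟩
  obtain ⟨C, -, ⟨b, hb, hgb, h₁, h₂⟩, hC⟩ := hh i
  rw [← hC _ hb] at h₁
  rw [← hC _ hgb] at h₂
  -- The conjugate sends `h b` to `h (g b)`, already beyond `r i`, and `h b < l i`.
  refine h₂.trans ?_
  simpa using (aut_lt_iff (h * g * h⁻¹) _ _).2 h₁

end Window

/-- An automorphism moving points upwards cofinally and downwards coinitially has a commutator
which moves points upwards both cofinally and coinitially. -/
theorem exists_commutator_pos (hD : HasDenseOrbits L N) {g : N ≃[L] N}
    (hgr : ∀ c, ∃ z, c < z ∧ z < g z) (hgl : ∀ c, ∃ z, z < c ∧ g z < z) :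
    ∃ h : N ≃[L] N, (∀ c, ∃ z, c < z ∧ z < (g⁻¹ * (h * g * h⁻¹)) z) ∧
      ∀ c, ∃ z, z < c ∧ z < (g⁻¹ * (h * g * h⁻¹)) z := by
  classical
  -- With `u = h b`, the inequality `g u < h (g b)` says that the commutator moves `u` up.
  let R : N ⊕ N → Approx L N → Prop := fun i C => ∃ b ∈ C.1, g b ∈ C.1 ∧
    g (C.2 b) < C.2 (g b) ∧ i.elim (fun c => c < C.2 b) (fun c => C.2 b < c)
  have hR : ∀ i C, True → ∃ D, Extends C D ∧ True ∧ R i D := by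
    rintro (c | c) ⟨A, H⟩ -
    -- Upper end: `g b` is a new largest point, so the conjugate can move `u` up further than `g`
    -- does.
    · have : Nonempty N := ⟨c⟩
      obtain ⟨a₀, ha₀⟩ := A.exists_le
      obtain ⟨c₀, hc₀⟩ := (insert c (A.image H)).exists_le
      obtain ⟨u, hcu, hu⟩ := hgr c₀
      obtain ⟨u', hu', -⟩ := hgr (g u)
      obtain ⟨z, haz, hz⟩ := hgr a₀
      have hHu : ∀ a ∈ A, H a < u := fun a ha => (hc₀ _ (by simp [ha])).trans_lt hcu
      obtain ⟨b, H₁, hH₁, hb, hzb, hbg⟩ := hD.exists_extends_preimage A H (x := u)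
        (fun a ha h => (h ▸ hHu a ha).false) hz (fun a ha _ => (ha₀ a ha).trans_lt (haz.trans hz))
        (fun a ha h => (h.trans (hHu a ha)).false.elim)
      have hbgb : b < g b := hbg.trans ((aut_lt_iff g _ _).2 hzb)
      have hH₁A : ∀ a ∈ A, H₁ a = H a := hH₁.2
      have hlt : ∀ a ∈ insert b A, a < g b := by
        intro a ha
        rcases Finset.mem_insert.1 ha with rfl | ha
        · exact hbgb
        · exact ((ha₀ a ha).trans_lt (haz.trans hzb)).trans hbgb
      obtain ⟨H₂, hH₂, h₁, -⟩ := hD.exists_extends_apply (insert b A) H₁ (y := g b)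
        (fun h => (hlt _ h).false) hu'
        (fun a ha _ => by
          rcases Finset.mem_insert.1 ha with rfl | ha
          · rw [hb]; exact hu.trans hu'
          · rw [hH₁A a ha]; exact (hHu a ha).trans (hu.trans hu'))
        (fun a ha h => ((hlt a ha).trans h).false.elim)
      have hbu : H₂ b = u := (hH₂.2 b (by simp)).trans hb
      refine ⟨_, hH₁.trans hH₂, trivial, b, by simp, by simp, ?_, ?_⟩
      · change g (H₂ b) < H₂ (g b)
        rwa [hbu]
      · change c < H₂ b
        rw [hbu]
        exact (hc₀ c (by simp)).trans_lt hcu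
    -- Lower end: `g` moves both `b` and `u` down; sending `g b` into `(g u, u)` makes the conjugate
    -- move `u` down less far than `g` does.
    · have : Nonempty N := ⟨c⟩
      obtain ⟨a₀, ha₀⟩ := exists_forall_le A
      obtain ⟨c₀, hc₀⟩ := exists_forall_le (insert c (A.image H))
      obtain ⟨u, hcu, hu⟩ := hgl c₀
      obtain ⟨z, haz, hz⟩ := hgl a₀
      have hHu : ∀ a ∈ A, u < H a := fun a ha => hcu.trans_le (hc₀ _ (by simp [ha]))
      obtain ⟨b, H₁, hH₁, hb, hzb, hbg⟩ := hD.exists_extends_preimage A H (x := u)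
        (fun a ha h => (h ▸ hHu a ha).false) hz (fun a ha h => (h.trans (hHu a ha)).false.elim)
        (fun a ha _ => hz.trans (haz.trans_le (ha₀ a ha)))
      have hbgb : g b < b := ((aut_lt_iff g _ _).2 hbg).trans hzb
      have hH₁A : ∀ a ∈ A, H₁ a = H a := hH₁.2
      have hlt : ∀ a ∈ insert b A, g b < a := by
        intro a ha
        rcases Finset.mem_insert.1 ha with rfl | ha
        · exact hbgb
        · exact hbgb.trans (hbg.trans (haz.trans_le (ha₀ a ha)))
      obtain ⟨H₂, hH₂, h₁, -⟩ := hD.exists_extends_apply (insert b A) H₁ (y := g b)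
        (fun h => (hlt _ h).false) hu
        (fun a ha h => ((hlt a ha).trans h).false.elim)
        (fun a ha _ => by
          rcases Finset.mem_insert.1 ha with rfl | ha
          · rw [hb]; exact hu
          · rw [hH₁A a ha]; exact hu.trans (hHu a ha))
      have hbu : H₂ b = u := (hH₂.2 b (by simp)).trans hb
      refine ⟨_, hH₁.trans hH₂, trivial, b, by simp, by simp, ?_, ?_⟩
      · change g (H₂ b) < H₂ (g b)
        rwa [hbu]
      · change H₂ b < c
        rw [hbu]
        exact hcu.trans_le (hc₀ c (by simp))
  obtain ⟨h, hh⟩ := exists_generic (fun _ : Approx L N => True) R (∅, 1) trivial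
    (fun x C _ => ⟨(insert x C.1, C.2), extends_insert _ _ _, trivial, by simp⟩)
    (fun x C _ => ⟨(insert (C.2⁻¹ x) C.1, C.2), extends_insert _ _ _, trivial, C.2⁻¹ x,
      by simp, by simp⟩) hR
  have key : ∀ C : Approx L N, (∀ a ∈ C.1, h a = C.2 a) → ∀ b ∈ C.1, g b ∈ C.1 →
      g (C.2 b) < C.2 (g b) → C.2 b < (g⁻¹ * (h * g * h⁻¹)) (C.2 b) := by
    intro C hC b hb hgb hlt
    rw [← aut_lt_iff g]
    rw [← hC _ hb, ← hC _ hgb] at hlt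
    rw [← hC _ hb]
    simpa using hlt
  refine ⟨h, fun c => ?_, fun c => ?_⟩
  · obtain ⟨C, -, ⟨b, hb, hgb, hlt, hc⟩, hC⟩ := hh (.inl c)
    exact ⟨C.2 b, hc, key C hC b hb hgb hlt⟩
  · obtain ⟨C, -, ⟨b, hb, hgb, hlt, hc⟩, hC⟩ := hh (.inr c)
    exact ⟨C.2 b, hc, key C hC b hb hgb hlt⟩

end Jumps

/-! ### Assembling a single orbital -/

section SingleOrbital

theorem exists_nat_strictMono_cofinal {X : Type*} [Countable X] [LinearOrder X]
    [NoMaxOrder X] (x₀ : X) :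
    ∃ s : ℕ → X, StrictMono s ∧ s 0 = x₀ ∧ ∀ x, ∃ n, x < s n := by
  have : Nonempty X := ⟨x₀⟩
  obtain ⟨e, he⟩ := exists_surjective_nat X
  choose up hup using fun x : X => exists_gt x
  let s : ℕ → X := fun n => Nat.rec x₀ (fun k y => up (max y (e k))) n
  refine ⟨s, strictMono_nat_of_lt_succ fun n => ?_, rfl, fun x => ?_⟩
  · exact (le_max_left _ _).trans_lt (hup (max (s n) (e n)))
  · obtain ⟨n, rfl⟩ := he x
    exact ⟨n + 1, (le_max_right _ _).trans_lt (hup (max (s n) (e n)))⟩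

theorem exists_int_strictMono_cofinal_coinitial (X : Type*) [Countable X] [LinearOrder X]
    [Nonempty X] [NoMaxOrder X] [NoMinOrder X] :
    ∃ s : ℤ → X, StrictMono s ∧ (∀ x, ∃ i, x < s i) ∧ ∀ x, ∃ i, s i < x := by
  obtain ⟨x₀⟩ := ‹Nonempty X›
  have : Countable Xᵒᵈ := OrderDual.ofDual.injective.countable
  obtain ⟨a, ha, ha₀, hac⟩ := exists_nat_strictMono_cofinal x₀
  obtain ⟨b, hb, hb₀, hbc⟩ := exists_nat_strictMono_cofinal (X := Xᵒᵈ) (OrderDual.toDual x₀)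
  let s : ℤ → X
    | .ofNat n => a n
    | .negSucc n => OrderDual.ofDual (b (n + 1))
  have hs : ∀ n : ℕ, s (-n) = OrderDual.ofDual (b n) := by
    rintro (_ | n)
    · rw [hb₀]; exact ha₀
    · rfl
  refine ⟨s, strictMono_int_of_lt_succ fun i => ?_, fun x => ?_, fun x => ?_⟩
  · obtain ⟨n, rfl | rfl⟩ := i.eq_nat_or_neg
    · exact ha (Nat.lt_succ_self n)
    · rcases n with _ | n
      · exact ha Nat.zero_lt_one
      · rw [show -((n + 1 : ℕ) : ℤ) + 1 = -(n : ℕ) by push_cast; ring, hs, hs]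
        exact hb (Nat.lt_succ_self n)
  · obtain ⟨n, hn⟩ := hac x
    exact ⟨n, hn⟩
  · obtain ⟨n, hn⟩ := hbc (OrderDual.toDual x)
    exact ⟨-n, (hs n).trans_lt hn⟩

variable {L : FirstOrder.Language.{u, v}} {N : Type w} [L.Structure N] [LinearOrder N]

/-- Normal closures make the successive constructions compose; only the end result is unfolded into
a list. -/
theorem isProductOfConjugates_of_mem_normalClosure {G : Type*} [Group G] {g f : G}
    (h : f ∈ Subgroup.normalClosure {g}) : IsProductOfConjugates g f := by
  have h' : f ∈ Submonoid.closure
      (Group.conjugatesOfSet {g} ∪ (Group.conjugatesOfSet {g})⁻¹) := by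
    rw [← Subgroup.closure_toSubmonoid]
    exact h
  obtain ⟨l, hl, rfl⟩ := Submonoid.exists_list_of_mem_closure h'
  refine ⟨l, fun k hk => ?_, rfl⟩
  rcases hl k hk with h | h
  · obtain ⟨a, rfl, ha⟩ := Group.mem_conjugatesOfSet_iff.1 h
    exact .inl ha
  · obtain ⟨a, rfl, ha⟩ := Group.mem_conjugatesOfSet_iff.1 h
    obtain ⟨c, hc⟩ := isConj_iff.1 ha
    refine .inr (isConj_iff.2 ⟨c, ?_⟩)
    rw [← inv_inv k, ← hc]
    group

section Ordered

variable [L.IsOrdered] [L.OrderedStructure N]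

theorem hasSinglePlusOrbital_of_seq (f : N ≃[L] N) (e : ℤ → N) (he : ∀ i, e (i + 1) < f (e i))
    (hcof : ∀ x, ∃ i, x < e i) (hcoi : ∀ x, ∃ i, e i < x) (hmono : StrictMono e) :
    HasSinglePlusOrbital f := by
  have hpos : ∀ x, x < f x := by
    intro x
    obtain ⟨i, hi⟩ := hcof x
    obtain ⟨j, hj⟩ := hcoi x
    -- For `e k ≤ x < e (k + 1)`, monotonicity gives `x < e (k + 1) < f (e k) ≤ f x`.
    obtain ⟨k, hk, hkmax⟩ := Int.exists_greatest_of_bdd (P := fun k => e k ≤ x)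
      ⟨i, fun k hk => hmono.le_iff_le.1 (hk.trans hi.le)⟩ ⟨j, hj.le⟩
    have hx : x < e (k + 1) := by
      by_contra h
      exact absurd (hkmax _ (not_lt.1 h)) (by omega)
    exact hx.trans ((he k).trans_le ((aut_le_iff f _ _).2 hk))
  have hup : ∀ n : ℕ, e n ≤ (f ^ (n : ℤ)) (e 0) := by
    intro n
    induction n with
    | zero => simp
    | succ n ih =>
      rw [Nat.cast_succ, add_comm, zpow_add, zpow_one, aut_mul_apply, add_comm]
      exact (he n).le.trans ((aut_le_iff f _ _).2 ih)
  have hdown : ∀ n : ℕ, (f ^ (-(n : ℤ))) (e 0) ≤ e (-n) := by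
    intro n
    induction n with
    | zero => simp
    | succ n ih =>
      rw [show -((n + 1 : ℕ) : ℤ) = -1 + -n by push_cast; ring, zpow_add, zpow_neg_one,
        aut_mul_apply, ← aut_le_iff f, aut_apply_inv_self]
      refine ih.trans ?_
      have := (he (-1 + -n)).le
      rwa [show (-1 + -(n : ℤ)) + 1 = -n by ring] at this
  refine ⟨e 0, ⟨fun x => ?_, fun x => ?_⟩, ⟨_, rfl⟩, fun a _ => hpos a⟩
  · obtain ⟨i, hi⟩ := hcof x
    exact ⟨i.toNat, (hi.trans_le (hmono.monotone (Int.self_le_toNat i))).trans_le (hup _)⟩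
  · obtain ⟨i, hi⟩ := hcoi x
    exact ⟨-((-i).toNat : ℤ), (hdown _).trans_lt
      ((hmono.monotone (by omega)).trans_lt hi)⟩

theorem HasSinglePlusOrbital.inv {f : N ≃[L] N} (hf : HasSinglePlusOrbital f) :
    HasSingleMinusOrbital f⁻¹ := by
  obtain ⟨a, ⟨hcof, hcoi⟩, -, hpos⟩ := hf
  refine ⟨a, ⟨fun x => ?_, fun x => ?_⟩, ⟨_, rfl⟩, fun b _ => ?_⟩
  · obtain ⟨i, hi⟩ := hcof x
    exact ⟨-i, by simpa using hi⟩
  · obtain ⟨i, hi⟩ := hcoi x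
    exact ⟨-i, by simpa using hi⟩
  · obtain ⟨i, hi⟩ := hcof b
    obtain ⟨j, hj⟩ := hcoi b
    have := hpos b ⟨_, ⟨j, rfl⟩, _, ⟨i, rfl⟩, hj.le, hi.le⟩
    rwa [← aut_lt_iff f, aut_apply_inv_self]

theorem exists_pos_mem_normalClosure_aux [L.IsRelational] [Countable N]
    (hD : HasDenseOrbits L N) {g : N ≃[L] N}
    (hgl : ∀ c, ∃ z, z < c ∧ g z ≠ z) (hgr : ∀ c, ∃ z, c < z ∧ z < g z) :
    ∃ f ∈ Subgroup.normalClosure {g}, (∀ c, ∃ z, c < z ∧ z < f z) ∧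
      ∀ c, ∃ z, z < c ∧ z < f z := by
  have hg : g ∈ Subgroup.normalClosure {g} := Subgroup.subset_normalClosure rfl
  by_cases hl : ∀ c, ∃ z, z < c ∧ z < g z
  · exact ⟨g, hg, hgr, hl⟩
  · push Not at hl
    obtain ⟨c₀, hc₀⟩ := hl
    obtain ⟨h, hh⟩ := exists_commutator_pos hD hgr fun c => by
      obtain ⟨z, hz, hgz⟩ := hgl (min c c₀)
      exact ⟨z, hz.trans_le (min_le_left _ _),
        (hc₀ z (hz.trans_le (min_le_right _ _))).lt_of_ne hgz⟩
    exact ⟨_, mul_mem (inv_mem hg) (Subgroup.normalClosure_normal.conj_mem g hg h), hh⟩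

theorem Unbounded.exists_pos_mem_normalClosure [L.IsRelational] [Countable N]
    (hD : HasDenseOrbits L N) {g : N ≃[L] N} (hg : Unbounded g) :
    ∃ f ∈ Subgroup.normalClosure {g}, (∀ c, ∃ z, c < z ∧ z < f z) ∧
      ∀ c, ∃ z, z < c ∧ z < f z := by
  obtain ⟨hgl, hgr⟩ := hg
  simp only [LeftBounded, RightBounded] at hgl hgr
  push Not at hgl hgr
  by_cases hr : ∀ c, ∃ z, c < z ∧ z < g z
  · exact exists_pos_mem_normalClosure_aux hD hgl hr
  · push Not at hr
    obtain ⟨c₀, hc₀⟩ := hr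
    obtain ⟨f, hf, h⟩ := exists_pos_mem_normalClosure_aux hD (g := g⁻¹)
      (fun c => by
        obtain ⟨z, hz, hgz⟩ := hgl c
        refine ⟨z, hz, fun h => hgz ?_⟩
        rw [← h, aut_apply_inv_self, h])
      (fun c => by
        obtain ⟨z, hz, hgz⟩ := hgr (max c c₀)
        refine ⟨z, (le_max_left _ _).trans_lt hz, ?_⟩
        rw [← aut_lt_iff g, aut_apply_inv_self]
        exact (hc₀ z ((le_max_right _ _).trans_lt hz)).lt_of_ne hgz)
    refine ⟨f, ?_, h⟩
    refine Subgroup.normalClosure_le_normal ?_ hf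
    exact Set.singleton_subset_iff.2 (inv_mem (Subgroup.subset_normalClosure rfl))

theorem exists_singlePlusOrbital [L.IsRelational] [Countable N] [Nonempty N]
    (hD : HasDenseOrbits L N) {g : N ≃[L] N} (hgr : ∀ c, ∃ z, c < z ∧ z < g z)
    (hgl : ∀ c, ∃ z, z < c ∧ z < g z) :
    ∃ f ∈ Subgroup.normalClosure {g}, HasSinglePlusOrbital f := by
  have : NoMaxOrder N := ⟨fun c => (hgr c).imp fun _ h => h.1⟩
  have : NoMinOrder N := ⟨fun c => (hgl c).imp fun _ h => h.1⟩
  obtain ⟨s, hs, hcof, hcoi⟩ := exists_int_strictMono_cofinal_coinitial N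
  have hlt : ∀ i j, i < j → s i < s j := fun i j h => hs h
  have hcof' : ∀ (k : ℤ) x, ∃ i, x < s (4 * i + k) := fun k x => by
    obtain ⟨i, hi⟩ := hcof x
    exact ⟨|i| + |k|, hi.trans_le (hs.monotone
      (by have := le_abs_self i; have := abs_nonneg i; have := neg_abs_le k; have := abs_nonneg k; omega))⟩
  have hcoi' : ∀ (k : ℤ) x, ∃ i, s (4 * i + k) < x := fun k x => by
    obtain ⟨i, hi⟩ := hcoi x
    exact ⟨-|i| - |k|, (hs.monotone
      (by have := neg_abs_le i; have := abs_nonneg i; have := le_abs_self k; have := abs_nonneg k; omega)).trans_lt hi⟩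
  -- The two conjugates jump from `4i + 1` past `4i + 3` and from `4i + 3` past `4i + 5`; the
  -- indices `4i` and `4i + 2` separate their respective intervals.
  obtain ⟨h₁, hh₁⟩ := exists_conj_jump hD hgr hgl (p := fun i => s (4 * i + 0))
    (l := fun i => s (4 * i + 1)) (r := fun i => s (4 * i + 3))
    (fun i => hlt _ _ (by omega)) (fun i => hlt _ _ (by omega)) (fun i => hlt _ _ (by omega))
    (hcof' 0) (hcoi' 0)
  obtain ⟨h₂, hh₂⟩ := exists_conj_jump hD hgr hgl (p := fun i => s (4 * i + 2))
    (l := fun i => s (4 * i + 3)) (r := fun i => s (4 * i + 5))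
    (fun i => hlt _ _ (by omega)) (fun i => hlt _ _ (by omega)) (fun i => hlt _ _ (by omega))
    (hcof' 2) (hcoi' 2)
  have hg : g ∈ Subgroup.normalClosure {g} := Subgroup.subset_normalClosure rfl
  refine ⟨(h₂ * g * h₂⁻¹) * (h₁ * g * h₁⁻¹), mul_mem
    (Subgroup.normalClosure_normal.conj_mem g hg h₂)
    (Subgroup.normalClosure_normal.conj_mem g hg h₁),
    hasSinglePlusOrbital_of_seq _ (fun i => s (4 * i + 1)) (fun i => ?_) (hcof' 1) (hcoi' 1)
    fun i j hij => hlt _ _ (by omega)⟩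
  rw [aut_mul_apply, show 4 * (i + 1) + 1 = 4 * i + 5 by ring]
  exact (hh₂ i).trans ((aut_lt_iff (h₂ * g * h₂⁻¹) _ _).2 (hh₁ i))

end Ordered

end SingleOrbital

end LinExp

theorem theorem2p11 {L : FirstOrder.Language.{u, v}} [L.IsRelational]
    -- a countable homogeneous `L`-structure whose age has strong amalgamation
    (M : Type w) [L.Structure M] [Countable M] [Nonempty M]
    (hM : L.IsUltrahomogeneous M) (hK : LinExp.StrongAmalgamation (L.age M))
    -- its linear order expansion
    (N : Type w) [(L.sum Language.order).Structure N] [Countable N] [LinearOrder N]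
    [(L.sum Language.order).OrderedStructure N]
    (hN : IsFraisseLimit (LinExp.orderExpansionClass (L.age M)) N)
    (g : N ≃[L.sum Language.order] N) (hg : LinExp.Unbounded g) :
    (∃ f : N ≃[L.sum Language.order] N,
      LinExp.IsProductOfConjugates g f ∧ LinExp.HasSinglePlusOrbital f) ∧
    (∃ f : N ≃[L.sum Language.order] N,
      LinExp.IsProductOfConjugates g f ∧ LinExp.HasSingleMinusOrbital f) := by
  have : Nonempty N := LinExp.nonempty_of_age hN.age
  have hD : LinExp.HasDenseOrbits (L.sum Language.order) N :=
    fun B x p q hx hpq hq hp =>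
      LinExp.orbit_dense hK hN.age hN.ultrahomogeneous B hx hpq hq hp
  obtain ⟨k, hk, hkr, hkl⟩ := hg.exists_pos_mem_normalClosure hD
  obtain ⟨f, hf, hplus⟩ := LinExp.exists_singlePlusOrbital hD hkr hkl
  have hfg : f ∈ Subgroup.normalClosure {g} :=
    Subgroup.normalClosure_le_normal (Set.singleton_subset_iff.2 hk) hf
  exact ⟨⟨f, LinExp.isProductOfConjugates_of_mem_normalClosure hfg, hplus⟩,
    ⟨f⁻¹, LinExp.isProductOfConjugates_of_mem_normalClosure (inv_mem hfg), hplus.inv⟩⟩
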